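/- Let $[m]=\{1,\dots,m\}$ and let $\gamma$ be the Euler--Mascheroni constant. For $k\ge 1$, a set $A$ of positive integers is called $k$-multiplicative if, for all $x,y\in A$ and all $a,b\in[k]$, $ax=by$ implies $a=b$ and $x=y$. Let $S_k$ be the set of positive integers coprime to the product of all primes $p\le k$. For $k\ge2$, $\varepsilon>0$, $n\ge1$ put $$B(k,\varepsilon,n)=\frac{(2+\varepsilon)\,n}{e^{\gamma}\log k}+\frac{2n}{k^{1/4}} .$$ **Theorem.** There are thresholds $n(k,\varepsilon)$, depending only on $k$ and $\varepsilon$, such that the following holds. 1. For every integer $k\ge2$, every $\varepsilon>0$ and every $n>n(k,\varepsilon)$, every $k$-multiplicative set $A\subseteq[n]$ satisfies $|A|\le B(k,\varepsilon,n)$. 2. For $n>n(k,\varepsilon)$, $$B(k,\varepsilon,n)=(2+o(1))\,|S_k\cap[n]|=\frac{(2+o(1))\,n}{e^{\gamma}\log k},$$ where $o(1)$ refers to $k\to\infty$ and $\varepsilon\to0$: for every $\eta>0$ there are $K$ and $\varepsilon_0>0$ such that for all $k\ge \max(K,2)$, all $0<\varepsilon\le\varepsilon_0$ and all $n>n(k,\varepsilon)$,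 $$\bigl|B(k,\varepsilon,n)-2|S_k\cap[n]|\bigr|\le\eta\,|S_k\cap[n]|\quad\text{and}\quad \Bigl|B(k,\varepsilon,n)-\frac{2n}{e^{\gamma}\log k}\Bigr|\le\frac{\eta\, n}{e^{\gamma}\log k}.$$ 3. Consequently $S_k$ is optimal up to a factor $2$, asymptotically: $S_k$ is $k$-multiplicative for every $k\ge1$, and for every $\eta>0$ there is $K$ such that for every $k\ge K$ and all sufficiently large $n$ (depending on $k$ and $\eta$), every $k$-multiplicative set $A\subseteq[n]$ satisfies $|A|\le(2+\eta)\,|S_k\cap[n]|$. -/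

import Mathlib

/-- `A ⊆ {1, 2, …}` is `k`-multiplicative (Sidon): `a x = b y` with `x, y ∈ A` and `a, b ∈ [k]`
forces `a = b` and `x = y`. -/
def IsKMultiplicative (k : ℕ) (A : Set ℕ) : Prop :=
  (∀ x ∈ A, 1 ≤ x) ∧
    ∀ x ∈ A, ∀ y ∈ A, ∀ a ∈ Set.Icc 1 k, ∀ b ∈ Set.Icc 1 k, a * x = b * y → a = b ∧ x = y

/-- `S_k`: the positive integers coprime to the product of all primes in `[k]`. -/
def roughSet (k : ℕ) : Set ℕ :=
  {s | 1 ≤ s ∧ Nat.gcd s (primorial k) = 1}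

/-- The cardinality `|S_k ∩ [n]|`. -/
noncomputable def roughCount (k n : ℕ) : ℕ :=
  (roughSet k ∩ Set.Icc 1 n).ncard

/-- The quantity `n / (e ^ γ log k)`, with `γ` the Euler–Mascheroni constant. -/
noncomputable def mertensMain (k n : ℕ) : ℝ :=
  (n : ℝ) / (Real.exp Real.eulerMascheroniConstant * Real.log k)

/-- The bound `(2 + ε) n / (e ^ γ log k) + 2 n / k ^ (1/4)`. -/
noncomputable def sidonBound (k : ℕ) (ε : ℝ) (n : ℕ) : ℝ :=
  (2 + ε) * (n : ℝ) / (Real.exp Real.eulerMascheroniConstant * Real.log k)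
    + 2 * (n : ℝ) / (k : ℝ) ^ (1 / 4 : ℝ)

/-! The upper bound comes from an injection. Write each `x ∈ A` as `d x * h x` with `d x` its
largest divisor in `[k]`. If `h x = h y`, then `d y * x = d x * y`, so `x = y`. If a prime `p ≤ N`
divides `h x`, maximality forces `d x * p > k`, hence `h x ≤ n N / k`; all other quotients are free
of primes up to `N`. This is `card_le_roughCount_add`.

With `N = ⌊k ^ (3/4)⌋` the small quotients number at most `n / k ^ (1/4)`. The others have density
about `(4/3) / (e ^ γ log k)` by Mertens, which leaves room below the claimed factor 2. The bound is
needed for every `k ≥ 2`, so `sieveDensity_floor_le` combines an explicit Mertens estimate for large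
`k` with the elementary `1 / sieveDensity N ≥ log (N + 1)` for the rest.

Mertens' third theorem, with its constant, is proved along the way. The estimate `∑ Λ n / n = log N
+ O(1)` follows from `log N!`, and partial summation gives `∑ Λ n / (n log n) = log log N + c + O(1
/ log N)`. The constant is `γ` (`eq_eulerMascheroniConstant_of_tendsto`) because Abel's theorem on
dyadic blocks, compared with `log ζ(1 + σ) ~ -log σ`, leaves only the harmonic-sum constant. Passing
from prime powers to the Euler product costs `o(1)`. -/

/-! ### Density and multiplicativity of the rough numbers. -/

/-- The density `∏ (1 - 1/p)`, over the primes `p ≤ N`, of the integers free of primes up to `N`. -/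
noncomputable def sieveDensity (N : ℕ) : ℝ :=
  ∏ p ∈ N.primesLE, (1 - (p : ℝ)⁻¹)

lemma sieveDensity_pos (N : ℕ) : 0 < sieveDensity N := by
  refine Finset.prod_pos fun p hp => ?_
  have hp' : p.Prime := (Nat.mem_primesLE.1 hp).2
  have : (p : ℝ)⁻¹ < 1 := inv_lt_one_of_one_lt₀ (by exact_mod_cast hp'.one_lt)
  linarith

lemma totient_primorial (N : ℕ) :
    ((primorial N).totient : ℝ) = primorial N * sieveDensity N := by
  have h := Nat.totient_eq_mul_prod_factors (primorial N)
  rw [primeFactors_primorial] at h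
  have h' := congrArg (fun q : ℚ => (q : ℝ)) h
  push_cast at h'
  exact h'

/-- Elements of `S_k` are coprime to every multiplier in `[k]`, so `a * x = b * y` gives `x ∣ y` and
`y ∣ x`. -/
lemma roughSet_isKMultiplicative {k : ℕ} :
    IsKMultiplicative k (roughSet k) := by
  refine ⟨fun x hx => hx.1, ?_⟩
  have coprime_of_le : ∀ s ∈ roughSet k, ∀ b ∈ Set.Icc 1 k, Nat.Coprime s b := by
    intro s hs b hb
    refine Nat.Coprime.symm (Nat.coprime_of_dvd fun p hp hpb hps => ?_)
    have hpk : p ≤ k := (Nat.le_of_dvd hb.1 hpb).trans hb.2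
    have : p ∣ Nat.gcd s (primorial k) := Nat.dvd_gcd hps (hp.dvd_primorial_iff.2 hpk)
    rw [hs.2] at this
    exact hp.one_lt.ne' (Nat.dvd_one.1 this)
  intro x hx y hy a ha b hb h
  have hxy : x ∣ y := (coprime_of_le x hx b hb).dvd_of_dvd_mul_left (h ▸ Dvd.intro_left a rfl)
  have hyx : y ∣ x := (coprime_of_le y hy a ha).dvd_of_dvd_mul_left (h ▸ Dvd.intro_left b rfl)
  have hxy' : x = y := Nat.dvd_antisymm hxy hyx
  subst hxy'
  exact ⟨Nat.eq_of_mul_eq_mul_right hx.1 h, rfl⟩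

lemma roughSet_inter_Icc (k n : ℕ) :
    roughSet k ∩ Set.Icc 1 n = ((Finset.Ico 1 (1 + n)).filter (primorial k).Coprime : Finset ℕ) := by
  ext s
  simp only [roughSet, Set.mem_inter_iff, Set.mem_ofPred_eq, Set.mem_Icc, Finset.coe_filter,
    Finset.mem_Ico, Nat.coprime_comm (m := primorial k)]
  unfold Nat.Coprime
  constructor
  · rintro ⟨⟨_, h⟩, _, _⟩
    exact ⟨by omega, h⟩
  · rintro ⟨_, h⟩
    exact ⟨⟨by omega, h⟩, by omega⟩

lemma roughCount_eq_card (k n : ℕ) :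
    roughCount k n = ((Finset.Ico 1 (1 + n)).filter (primorial k).Coprime).card := by
  rw [roughCount, roughSet_inter_Icc, Set.ncard_coe_finset]

lemma totient_mul_div_le_card (a k n : ℕ) :
    a.totient * (n / a) ≤ ((Finset.Ico k (k + n)).filter a.Coprime).card := by
  have periods : ∀ q, ((Finset.Ico k (k + a * q)).filter a.Coprime).card = a.totient * q := by
    intro q
    induction q with
    | zero => simp
    | succ q ih =>
      rw [← Finset.Ico_union_Ico_eq_Ico (b := k + a * q) (by omega)
        (by rw [mul_add]; omega), Finset.filter_union, Finset.card_union_of_disjoint, ih,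
        mul_add a, ← add_assoc, mul_one, Nat.filter_coprime_Ico_eq_totient, mul_add, mul_one]
      exact Finset.disjoint_filter_filter (Finset.Ico_disjoint_Ico_consecutive _ _ _)
  rw [← periods]
  refine Finset.card_le_card (Finset.filter_subset_filter _ (Finset.Ico_subset_Ico le_rfl ?_))
  have := Nat.mul_div_le n a
  omega

/-- Coprimality to `P` has period `P`: the count lies between `φ(P) ⌊n/P⌋` and `φ(P) (⌊n/P⌋ + 1)`,
as does `φ(P) n / P`, so the error is at most `φ(P) ≤ P`. -/
lemma abs_roughCount_sub_le (k n : ℕ) :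
    |(roughCount k n : ℝ) - sieveDensity k * n| ≤ primorial k := by
  set P := primorial k with hP
  have hP0 : 0 < P := primorial_pos k
  have hPr : (0 : ℝ) < P := by exact_mod_cast hP0
  have upper : (roughCount k n : ℝ) ≤ P.totient * ((n / P : ℕ) + 1) := by
    rw [roughCount_eq_card]
    exact_mod_cast Nat.Ico_filter_coprime_le 1 n hP0.ne'
  have lower : (P.totient : ℝ) * (n / P : ℕ) ≤ roughCount k n := by
    rw [roughCount_eq_card]
    exact_mod_cast totient_mul_div_le_card P 1 n
  have floor_le : ((n / P : ℕ) : ℝ) ≤ n / P := Nat.cast_div_le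
  have le_floor : (n : ℝ) / P ≤ (n / P : ℕ) + 1 := by
    rw [div_le_iff₀ hPr]
    have := Nat.lt_div_mul_add (a := n) hP0
    have : n ≤ (n / P + 1) * P := by rw [add_mul]; omega
    exact_mod_cast this
  have totient_le : (P.totient : ℝ) ≤ P := by exact_mod_cast Nat.totient_le P
  have main : sieveDensity k * n = P.totient * (n / P) := by
    rw [hP, totient_primorial, ← hP]
    field_simp
  have hφ : (0 : ℝ) ≤ P.totient := by positivity
  rw [main, abs_le]
  constructor <;> nlinarith

/-! ### Division by the largest divisor up to `k`. -/

/-- A `k`-multiplicative subset of `[n]` has at most `n N / k` more elements than there are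
integers in `[n]` without prime factor up to `N`: divide each element by its largest divisor
up to `k`. -/
lemma card_le_roughCount_add {k n : ℕ} (N : ℕ) (hk : 1 ≤ k) {A : Finset ℕ}
    (hA : A ⊆ Finset.Icc 1 n) (hmul : IsKMultiplicative k (A : Set ℕ)) :
    A.card ≤ roughCount N n + n * N / k := by
  have exists_divisor : ∀ x ∈ A, ∃ d h, d ∈ Set.Icc 1 k ∧ x = d * h ∧
      ∀ e, e ∣ x → e ≤ k → e ≤ d := by
    intro x hx
    have hx1 : 1 ≤ x := (Finset.mem_Icc.1 (hA hx)).1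
    have hne : (x.divisors.filter (· ≤ k)).Nonempty :=
      ⟨1, by simp only [Finset.mem_filter, Nat.mem_divisors]; exact ⟨⟨one_dvd _, by omega⟩, hk⟩⟩
    obtain ⟨d, hd, hmax⟩ := Finset.exists_max_image _ id hne
    simp only [Finset.mem_filter, Nat.mem_divisors] at hd
    obtain ⟨⟨⟨h, rfl⟩, h0⟩, hdk⟩ := hd
    refine ⟨d, h, ⟨Nat.pos_of_ne_zero (left_ne_zero_of_mul h0), hdk⟩, rfl, fun e he hek => ?_⟩
    exact hmax e (by simp only [Finset.mem_filter, Nat.mem_divisors]; exact ⟨⟨he, h0⟩, hek⟩)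
  choose! d h hd hx hmax using exists_divisor
  have h_inj : Set.InjOn h (A : Set ℕ) := by
    intro x hxA y hyA hxy
    -- The multipliers are exchanged: each element is multiplied by the divisor of the other.
    refine (hmul.2 x hxA y hyA (d y) (hd y hyA) (d x) (hd x hxA) ?_).2
    calc d y * x = d y * (d x * h x) := by rw [← hx x hxA]
      _ = d x * (d y * h y) := by rw [hxy]; ring
      _ = d x * y := by rw [← hx y hyA]
  have h_maps : A.image h ⊆
      (Finset.Ico 1 (1 + n)).filter (primorial N).Coprime ∪ Finset.Icc 1 (n * N / k) := by
    intro m hm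
    obtain ⟨x, hxA, rfl⟩ := Finset.mem_image.1 hm
    obtain ⟨hx1, hxn⟩ := Finset.mem_Icc.1 (hA hxA)
    have hxe := hx x hxA
    have hh1 : 1 ≤ h x := Nat.pos_of_ne_zero fun h0 => by rw [h0] at hxe; omega
    have hhx : h x ≤ x := by
      conv_rhs => rw [hxe]
      exact Nat.le_mul_of_pos_left _ (hd x hxA).1
    rw [Finset.mem_union, Finset.mem_filter, Finset.mem_Ico, Finset.mem_Icc]
    by_cases hc : (primorial N).Coprime (h x)
    · exact Or.inl ⟨by omega, hc⟩
    · right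
      obtain ⟨p, hp, hpN, hph⟩ := Nat.Prime.not_coprime_iff_dvd.1 hc
      rw [hp.dvd_primorial_iff] at hpN
      refine ⟨hh1, ?_⟩
      rw [Nat.le_div_iff_mul_le (by omega)]
      -- Otherwise `d x * p` would be a larger divisor of `x` in `[k]`.
      have hdp : k < d x * p := by
        by_contra! hle
        have hdvd : d x * p ∣ x := by
          conv_rhs => rw [hxe]
          exact Nat.mul_dvd_mul_left _ hph
        have h1 := hmax x hxA _ hdvd hle
        have h2 := (hd x hxA).1
        have h3 := hp.two_le
        nlinarith
      calc h x * k ≤ h x * (d x * N) :=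
            Nat.mul_le_mul_left _ (hdp.le.trans (Nat.mul_le_mul_left _ hpN))
        _ = d x * h x * N := by ring
        _ = x * N := by rw [← hxe]
        _ ≤ n * N := Nat.mul_le_mul_right _ hxn
  calc A.card = (A.image h).card := (Finset.card_image_of_injOn h_inj).symm
    _ ≤ _ := Finset.card_le_card h_maps
    _ ≤ _ := Finset.card_union_le _ _
    _ = roughCount N n + n * N / k := by rw [roughCount_eq_card]; simp

/-! ### Bounds for `∑ Λ n / n` through `log N!`. -/

open ArithmeticFunction in
/-- The partial sum of `Λ n / n` up to `N`. -/
noncomputable def vonMangoldtSum (N : ℕ) : ℝ :=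
  ∑ n ∈ Finset.Ioc 0 N, vonMangoldt n / n

open ArithmeticFunction in
/-- The partial sum of `Λ n / (n log n)` up to `N`. -/
noncomputable def vonMangoldtLogSum (N : ℕ) : ℝ :=
  ∑ n ∈ Finset.Ioc 0 N, vonMangoldt n / (n * Real.log n)

open ArithmeticFunction in
lemma log_factorial_eq_sum_vonMangoldt (N : ℕ) :
    Real.log N.factorial = ∑ n ∈ Finset.Ioc 0 N, vonMangoldt n * (N / n : ℕ) := by
  rw [← sum_Ioc_mul_zeta_eq_sum, vonMangoldt_mul_zeta]
  induction N with
  | zero => simp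
  | succ N ih =>
    rw [Nat.factorial_succ, Nat.cast_mul, Real.log_mul (by positivity) (by positivity), ih,
      ← Finset.insert_Ioc_right_eq_Ioc_add_one (by omega), Finset.sum_insert (by simp)]
    simp

lemma log_factorial_ge (N : ℕ) : N * Real.log N - N ≤ Real.log N.factorial := by
  rcases Nat.eq_zero_or_pos N with rfl | hN
  · simp
  have hN' : (0 : ℝ) < N := by exact_mod_cast hN
  have h := Real.pow_div_factorial_le_exp N hN'.le N
  have h' := Real.log_le_log (by positivity) h
  rw [Real.log_exp, Real.log_div (by positivity) (by positivity), Real.log_pow] at h'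
  linarith

lemma log_factorial_le (N : ℕ) : Real.log N.factorial ≤ N * Real.log N := by
  rw [← Real.log_pow]
  exact Real.log_le_log (by positivity) (by exact_mod_cast Nat.factorial_le_pow N)

open ArithmeticFunction in
lemma log_sub_one_le_vonMangoldtSum {N : ℕ} (hN : 1 ≤ N) :
    Real.log N - 1 ≤ vonMangoldtSum N := by
  have hN' : (0 : ℝ) < N := by exact_mod_cast hN
  have h : Real.log N.factorial ≤ N * vonMangoldtSum N := by
    rw [log_factorial_eq_sum_vonMangoldt, vonMangoldtSum, Finset.mul_sum]
    refine Finset.sum_le_sum fun n _ => ?_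
    calc vonMangoldt n * ((N / n : ℕ) : ℝ) ≤ vonMangoldt n * (N / n) :=
          mul_le_mul_of_nonneg_left Nat.cast_div_le vonMangoldt_nonneg
      _ = N * (vonMangoldt n / n) := by ring
  have h' := (log_factorial_ge N).trans h
  have : N * (Real.log N - 1) ≤ N * vonMangoldtSum N := by linarith
  exact le_of_mul_le_mul_left this hN'

open ArithmeticFunction in
lemma vonMangoldtSum_le_log_add {N : ℕ} (hN : 1 ≤ N) :
    vonMangoldtSum N ≤ Real.log N + Chebyshev.psi N / N := by
  have hN' : (0 : ℝ) < N := by exact_mod_cast hN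
  have h : N * vonMangoldtSum N ≤ Real.log N.factorial + Chebyshev.psi N := by
    rw [log_factorial_eq_sum_vonMangoldt, vonMangoldtSum, Finset.mul_sum, Chebyshev.psi,
      Nat.floor_natCast, ← Finset.sum_add_distrib]
    refine Finset.sum_le_sum fun n hn => ?_
    have hn0 : 0 < n := (Finset.mem_Ioc.1 hn).1
    have hle : (N : ℝ) / n ≤ (N / n : ℕ) + 1 := by
      rw [div_le_iff₀ (by exact_mod_cast hn0)]
      have := Nat.lt_div_mul_add (a := N) hn0
      have : N ≤ (N / n + 1) * n := by rw [add_mul]; omega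
      exact_mod_cast this
    calc N * (vonMangoldt n / n) = vonMangoldt n * (N / n) := by ring
      _ ≤ vonMangoldt n * ((N / n : ℕ) + 1) :=
          mul_le_mul_of_nonneg_left hle vonMangoldt_nonneg
      _ = _ := by ring
  have h' := h.trans (add_le_add_left (log_factorial_le N) _)
  have : N * vonMangoldtSum N ≤ N * (Real.log N + Chebyshev.psi N / N) := by
    rw [mul_add, mul_div_cancel₀ _ hN'.ne']
    linarith
  exact le_of_mul_le_mul_left this hN'

/-- Chebyshev's bound `ψ(N) ≤ N log 4 + 2 √N log N` in terms of `u = N ^ (1/4) ≥ 10`: `log 4 ≤ 1.4`,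
and the second term is at most `0.85 N`. -/
lemma psi_div_le {N : ℕ} (hN : 10000 ≤ N) : Chebyshev.psi N / N ≤ 9 / 4 := by
  have hN' : (10000 : ℝ) ≤ N := by exact_mod_cast hN
  have h0 : (0 : ℝ) < N := by linarith
  have h := Chebyshev.psi_le (x := N) (by linarith)
  have hlog4 : Real.log 4 ≤ 1.4 := by
    rw [show (4 : ℝ) = 2 ^ 2 by norm_num, Real.log_pow]
    have := Real.log_two_lt_d9
    push_cast
    linarith
  set u : ℝ := (N : ℝ) ^ (1 / 4 : ℝ) with hu
  have hu10 : 10 ≤ u := by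
    have h10 : (10 : ℝ) = (10000 : ℝ) ^ (1 / 4 : ℝ) := by
      rw [show (10000 : ℝ) = 10 ^ (4 : ℝ) by norm_num, ← Real.rpow_mul (by norm_num)]
      norm_num
    rw [h10, hu]
    exact Real.rpow_le_rpow (by norm_num) hN' (by norm_num)
  have hu4 : u ^ 4 = N := by
    rw [hu, ← Real.rpow_natCast, ← Real.rpow_mul h0.le]
    norm_num
  have hsqrt : √(N : ℝ) = u ^ 2 := by
    rw [← hu4, show u ^ 4 = (u ^ 2) ^ 2 by ring, Real.sqrt_sq (by positivity)]
  have hlogu : Real.log u ≤ u - 1 := Real.log_le_sub_one_of_pos (by positivity)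
  have hlogN : Real.log N = 4 * Real.log u := by
    rw [← hu4, Real.log_pow]
    norm_num
  rw [div_le_iff₀ h0]
  rw [hsqrt, hlogN] at h
  rw [← hu4] at h ⊢
  have hstep : 2 * u ^ 2 * (4 * Real.log u) ≤ u ^ 2 * (8 * (u - 1)) := by nlinarith [sq_nonneg u]
  have hlast : u ^ 2 * (8 * (u - 1)) ≤ u ^ 2 * (17 / 20 * u ^ 2) :=
    mul_le_mul_of_nonneg_left (by nlinarith) (sq_nonneg u)
  have h4 : Real.log 4 * u ^ 4 ≤ 1.4 * u ^ 4 := by gcongr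
  nlinarith

lemma vonMangoldtSum_succ (N : ℕ) : vonMangoldtSum (N + 1) =
    vonMangoldtSum N + ArithmeticFunction.vonMangoldt (N + 1) / (N + 1 : ℕ) := by
  rw [vonMangoldtSum, ← Finset.insert_Ioc_right_eq_Ioc_add_one (by omega),
    Finset.sum_insert (by simp), add_comm]
  rfl

lemma vonMangoldtLogSum_succ (N : ℕ) : vonMangoldtLogSum (N + 1) = vonMangoldtLogSum N +
    ArithmeticFunction.vonMangoldt (N + 1) / (N + 1 : ℕ) / Real.log (N + 1 : ℕ) := by
  rw [vonMangoldtLogSum, ← Finset.insert_Ioc_right_eq_Ioc_add_one (by omega),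
    Finset.sum_insert (by simp), add_comm, div_div]
  rfl

lemma vonMangoldtSum_le {N : ℕ} (hN : 10000 ≤ N) : vonMangoldtSum N ≤ Real.log N + 9 / 4 :=
  (vonMangoldtSum_le_log_add (by omega)).trans (by linarith [psi_div_le hN])

/-! ### Partial summation and convergence in Mertens' second theorem. -/

/-- `∑ Λ n / (n log n) - log log N`, corrected by partial summation with the constant `K`. -/
noncomputable def correctedLogSum (K : ℝ) (N : ℕ) : ℝ :=
  vonMangoldtLogSum N - Real.log (Real.log N) +
    (K - (vonMangoldtSum N - Real.log N)) / Real.log N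

lemma correctedLogSum_succ_sub (K : ℝ) {N : ℕ} (hN : 2 ≤ N) :
    correctedLogSum K (N + 1) - correctedLogSum K N =
      (K - (vonMangoldtSum N - Real.log N)) *
          ((Real.log (N + 1 : ℕ))⁻¹ - (Real.log N)⁻¹) +
        (1 - (Real.log (N + 1 : ℕ) / Real.log N)⁻¹) -
          Real.log (Real.log (N + 1 : ℕ) / Real.log N) := by
  have hv : 0 < Real.log N := Real.log_pos (by exact_mod_cast hN)
  have hu : 0 < Real.log (N + 1 : ℕ) := Real.log_pos (by exact_mod_cast (by omega : 1 < N + 1))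
  rw [correctedLogSum, correctedLogSum, vonMangoldtSum_succ, vonMangoldtLogSum_succ,
    Real.log_div hu.ne' hv.ne']
  field_simp
  ring

lemma log_succ_bounds {N : ℕ} (hN : 2 ≤ N) : 0 < Real.log N ∧
    Real.log N ≤ Real.log (N + 1 : ℕ) ∧ Real.log (N + 1 : ℕ) ≤ Real.log N + 1 / N := by
  have hN' : (2 : ℝ) ≤ N := by exact_mod_cast hN
  refine ⟨Real.log_pos (by linarith), Real.log_le_log (by linarith) (by push_cast; linarith), ?_⟩
  have h := Real.log_le_sub_one_of_pos (x := ((N + 1 : ℕ) : ℝ) / N) (by positivity)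
  rw [Real.log_div (by positivity) (by positivity)] at h
  have : ((N + 1 : ℕ) : ℝ) / N - 1 = 1 / N := by
    push_cast
    field_simp
    ring
  linarith

/-- The first term of the increment is nonpositive when `K` bounds the remainder from above; the
rest is `1 - 1/r ≤ log r` for the ratio `r` of consecutive logarithms. -/
lemma correctedLogSum_succ_le {K : ℝ} {N : ℕ} (hN : 2 ≤ N)
    (hK : vonMangoldtSum N ≤ Real.log N + K) :
    correctedLogSum K (N + 1) ≤ correctedLogSum K N := by
  obtain ⟨hv, hvu, -⟩ := log_succ_bounds hN
  have h := correctedLogSum_succ_sub K hN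
  have h1 := Real.one_sub_inv_le_log_of_pos (div_pos (hv.trans_le hvu) hv)
  have h2 : (K - (vonMangoldtSum N - Real.log N)) *
      ((Real.log (N + 1 : ℕ))⁻¹ - (Real.log N)⁻¹) ≤ 0 :=
    mul_nonpos_of_nonneg_of_nonpos (by linarith) (sub_nonpos.2 (inv_anti₀ hv hvu))
  linarith

/-- The remainder is at least `-1`; taking `-2` leaves a spare `1 ≥ log (N + 1) - log N`, which pays
for the gap between `log r` and `1 - 1/r`. -/
lemma le_correctedLogSum_succ {N : ℕ} (hN : 2 ≤ N) :
    correctedLogSum (-2) N ≤ correctedLogSum (-2) (N + 1) := by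
  obtain ⟨hv, hvu, huv⟩ := log_succ_bounds hN
  have hN' : (2 : ℝ) ≤ N := by exact_mod_cast hN
  have h := correctedLogSum_succ_sub (-2) hN
  have h1 := Real.log_le_sub_one_of_pos (div_pos (hv.trans_le hvu) hv)
  have hT := log_sub_one_le_vonMangoldtSum (N := N) (by omega)
  have hN1 : 1 / (N : ℝ) ≤ 1 := by rw [div_le_one (by linarith)]; linarith
  have hinv : (Real.log (N + 1 : ℕ))⁻¹ ≤ (Real.log N)⁻¹ := inv_anti₀ hv hvu
  have h2 : (Real.log (N + 1 : ℕ) - Real.log N) *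
      ((Real.log N)⁻¹ - (Real.log (N + 1 : ℕ))⁻¹) ≤ (2 + (vonMangoldtSum N - Real.log N)) *
      ((Real.log N)⁻¹ - (Real.log (N + 1 : ℕ))⁻¹) :=
    mul_le_mul_of_nonneg_right (by linarith) (by linarith)
  have h3 : (Real.log (N + 1 : ℕ) - Real.log N) * ((Real.log N)⁻¹ - (Real.log (N + 1 : ℕ))⁻¹) =
      (Real.log (N + 1 : ℕ) / Real.log N - 1) - (1 - (Real.log (N + 1 : ℕ) / Real.log N)⁻¹) := by
    have hu := hv.trans_le hvu
    field_simp
  linarith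

open Filter Topology in
/-- Mertens' second theorem for prime powers, with an unspecified constant. -/
lemma exists_tendsto_vonMangoldtLogSum_sub : ∃ c : ℝ,
    Tendsto (fun N : ℕ => vonMangoldtLogSum N - Real.log (Real.log N)) atTop (𝓝 c) ∧
      ∀ N : ℕ, 10000 ≤ N →
        c - 13 / 4 / Real.log N ≤ vonMangoldtLogSum N - Real.log (Real.log N) := by
  -- `G` decreases and stays above the increasing `H`, so it converges. Both corrections vanish in
  -- the limit, and `c ≤ G j` yields the explicit lower bound with `13/4 = 9/4 + 1`.
  set G : ℕ → ℝ := fun j => correctedLogSum (9 / 4) (j + 10000) with hG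
  set H : ℕ → ℝ := fun j => correctedLogSum (-2) (j + 10000) with hH
  have hGanti : Antitone G := antitone_nat_of_succ_le fun j => by
    have := correctedLogSum_succ_le (N := j + 10000) (by omega) (vonMangoldtSum_le (by omega))
    rwa [show j + 10000 + 1 = j + 1 + 10000 by omega] at this
  have hHmono : Monotone H := monotone_nat_of_le_succ fun j => by
    have := le_correctedLogSum_succ (N := j + 10000) (by omega)
    rwa [show j + 10000 + 1 = j + 1 + 10000 by omega] at this
  have hlogpos : ∀ N : ℕ, 10000 ≤ N → 0 < Real.log N := fun N hN =>
    (log_succ_bounds (by omega)).1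
  have hHG : ∀ j, H j ≤ G j := fun j => by
    simp only [hG, hH, correctedLogSum]
    have := hlogpos (j + 10000) (by omega)
    gcongr
    norm_num
  have hbdd : BddBelow (Set.range G) := ⟨H 0, by
    rintro _ ⟨j, rfl⟩
    exact (hHmono (Nat.zero_le j)).trans (hHG j)⟩
  have hlim := tendsto_atTop_ciInf hGanti hbdd
  set c := ⨅ j, G j with hc
  have hlogN : Tendsto (fun j : ℕ => Real.log ((j + 10000 : ℕ) : ℝ)) atTop atTop :=
    Real.tendsto_log_atTop.comp
      (tendsto_natCast_atTop_atTop.comp (tendsto_add_atTop_nat 10000))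
  have hcorr : Tendsto (fun j : ℕ =>
      (9 / 4 - (vonMangoldtSum (j + 10000) - Real.log ((j + 10000 : ℕ) : ℝ))) /
        Real.log ((j + 10000 : ℕ) : ℝ)) atTop (𝓝 0) := by
    refine squeeze_zero (fun j => ?_) (fun j => ?_) (hlogN.const_div_atTop (13 / 4))
    · have := vonMangoldtSum_le (N := j + 10000) (by omega)
      exact div_nonneg (by linarith) (hlogpos _ (by omega)).le
    · have := log_sub_one_le_vonMangoldtSum (N := j + 10000) (by omega)
      exact div_le_div_of_nonneg_right (by linarith) (hlogpos _ (by omega)).le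
  refine ⟨c, ?_, fun N hN => ?_⟩
  · rw [← tendsto_add_atTop_iff_nat 10000]
    have := hlim.sub hcorr
    rw [sub_zero] at this
    refine this.congr fun j => ?_
    simp only [hG, correctedLogSum]
    ring
  · have h1 : c ≤ correctedLogSum (9 / 4) N := by
      have := ciInf_le hbdd (N - 10000)
      simpa only [hG, Nat.sub_add_cancel hN] using this
    have h2 : (9 / 4 - (vonMangoldtSum N - Real.log N)) / Real.log N ≤ 13 / 4 / Real.log N := by
      have := log_sub_one_le_vonMangoldtSum (N := N) (by omega)
      exact div_le_div_of_nonneg_right (by linarith) (hlogpos _ hN).le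
    rw [correctedLogSum] at h1
    linarith

/-! ### Identification of the constant through the zeta function. -/

/-- The part of `∑ Λ n / (n log n)` over the dyadic block `2 ^ m < n ≤ 2 ^ (m + 1)`. -/
noncomputable def dyadicBlock (m : ℕ) : ℝ :=
  vonMangoldtLogSum (2 ^ (m + 1)) - vonMangoldtLogSum (2 ^ m)

lemma dyadicBlock_eq_sum (m : ℕ) : dyadicBlock m =
    ∑ n ∈ Finset.Ioc (2 ^ m) (2 ^ (m + 1)),
      ArithmeticFunction.vonMangoldt n / (n * Real.log n) := by
  rw [dyadicBlock, vonMangoldtLogSum, vonMangoldtLogSum, ← Finset.sum_Ioc_consecutive _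
    (Nat.zero_le (2 ^ m)) (Nat.pow_le_pow_right two_pos (Nat.le_succ m))]
  ring

lemma vonMangoldtLogSum_one : vonMangoldtLogSum 1 = 0 := by
  simp [vonMangoldtLogSum]

lemma vonMangoldt_term_nonneg (s : ℝ) (n : ℕ) :
    0 ≤ ArithmeticFunction.vonMangoldt n / ((n : ℝ) ^ s * Real.log n) :=
  div_nonneg ArithmeticFunction.vonMangoldt_nonneg
    (mul_nonneg (by positivity) (Real.log_natCast_nonneg n))

lemma vonMangoldt_term_eq (σ : ℝ) {n : ℕ} (hn : 0 < n) :
    ArithmeticFunction.vonMangoldt n / ((n : ℝ) ^ (1 + σ) * Real.log n) =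
      ArithmeticFunction.vonMangoldt n / (n * Real.log n) * (n : ℝ) ^ (-σ) := by
  have hn' : (0 : ℝ) < n := by exact_mod_cast hn
  rw [Real.rpow_add hn', Real.rpow_one, Real.rpow_neg hn'.le]
  ring

lemma two_pow_rpow_neg (σ : ℝ) (m : ℕ) :
    (((2 ^ m : ℕ) : ℝ)) ^ (-σ) = ((2 : ℝ) ^ (-σ)) ^ m := by
  push_cast
  rw [← Real.rpow_natCast, ← Real.rpow_natCast, ← Real.rpow_mul (by norm_num),
    ← Real.rpow_mul (by norm_num), mul_comm]

/-- On the block `2 ^ m < n ≤ 2 ^ (m + 1)`, the factor `n ^ (-σ)` lies between `x ^ (m + 1)` and `x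
^ m`, where `x = 2 ^ (-σ)`. -/
lemma sum_vonMangoldt_two_pow_bounds {σ : ℝ} (hσ : 0 ≤ σ) (M : ℕ) :
    ∑ m ∈ Finset.range M, dyadicBlock m * ((2 : ℝ) ^ (-σ)) ^ (m + 1) ≤
        ∑ n ∈ Finset.Ioc 0 (2 ^ M),
          ArithmeticFunction.vonMangoldt n / ((n : ℝ) ^ (1 + σ) * Real.log n) ∧
      ∑ n ∈ Finset.Ioc 0 (2 ^ M),
          ArithmeticFunction.vonMangoldt n / ((n : ℝ) ^ (1 + σ) * Real.log n) ≤
        ∑ m ∈ Finset.range M, dyadicBlock m * ((2 : ℝ) ^ (-σ)) ^ m := by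
  induction M with
  | zero => simp [show Finset.Ioc 0 1 = {1} from rfl]
  | succ M ih =>
    rw [← Finset.sum_Ioc_consecutive _ (Nat.zero_le (2 ^ M))
      (Nat.pow_le_pow_right two_pos (Nat.le_succ M)), Finset.sum_range_succ,
      Finset.sum_range_succ, dyadicBlock_eq_sum, Finset.sum_mul, Finset.sum_mul]
    have term_nonneg : ∀ n : ℕ, 0 ≤ ArithmeticFunction.vonMangoldt n / (n * Real.log n) :=
      fun n => by simpa using vonMangoldt_term_nonneg 1 n
    refine ⟨add_le_add ih.1 (Finset.sum_le_sum fun n hn => ?_),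
      add_le_add ih.2 (Finset.sum_le_sum fun n hn => ?_)⟩ <;>
    · obtain ⟨h1, h2⟩ := Finset.mem_Ioc.1 hn
      have hn0 : 0 < n := (Nat.zero_le _).trans_lt h1
      rw [vonMangoldt_term_eq σ hn0, ← two_pow_rpow_neg]
      refine mul_le_mul_of_nonneg_left ?_ (term_nonneg n)
      exact Real.rpow_le_rpow_of_nonpos (by positivity) (by exact_mod_cast (by omega))
        (by linarith)

open Filter Topology

lemma tendsto_sum_vonMangoldt_log_riemannZeta {σ : ℝ} (hσ : 0 < σ) :
    Tendsto (fun M : ℕ => ∑ n ∈ Finset.Ioc 0 (2 ^ M),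
      ArithmeticFunction.vonMangoldt n / ((n : ℝ) ^ (1 + σ) * Real.log n)) atTop
      (𝓝 (Real.log (riemannZeta ((1 + σ : ℝ) : ℂ)).re)) := by
  have hsum : Summable fun n : ℕ =>
      ArithmeticFunction.vonMangoldt n / ((n : ℝ) ^ (1 + σ) * Real.log n) := by
    refine Summable.of_nonneg_of_le (vonMangoldt_term_nonneg _) (fun n => ?_)
      (Real.summable_nat_rpow_inv.2 (by linarith : 1 < 1 + σ))
    rcases lt_or_ge 1 n with hn | hn
    · have hlog : 0 < Real.log n := Real.log_pos (by exact_mod_cast hn)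
      have hn' : (0 : ℝ) < (n : ℝ) ^ (1 + σ) := by positivity
      rw [div_le_iff₀ (by positivity), ← mul_assoc, inv_mul_cancel₀ hn'.ne', one_mul]
      exact ArithmeticFunction.vonMangoldt_le_log
    · have : ArithmeticFunction.vonMangoldt n = 0 := by interval_cases n <;> simp
      rw [this, zero_div]
      positivity
  rw [log_riemannZeta_eq (by linarith)]
  have h := hsum.tendsto_sum_tsum_nat.comp
    ((tendsto_add_atTop_nat 1).comp (tendsto_pow_atTop_atTop_of_one_lt (one_lt_two (α := ℕ))))
  refine h.congr fun M => ?_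
  simp only [Function.comp_apply]
  rw [Finset.range_eq_Ico, Finset.sum_eq_sum_Ico_succ_bot (by positivity)]
  simp only [ArithmeticFunction.map_zero, zero_div, zero_add]
  rfl

lemma tsum_dyadicBlock_bounds {σ : ℝ} (hσ : 0 < σ)
    (hsum : Summable fun m => dyadicBlock m * ((2 : ℝ) ^ (-σ)) ^ m) :
    (2 : ℝ) ^ (-σ) * ∑' m, dyadicBlock m * ((2 : ℝ) ^ (-σ)) ^ m ≤
        Real.log (riemannZeta ((1 + σ : ℝ) : ℂ)).re ∧
      Real.log (riemannZeta ((1 + σ : ℝ) : ℂ)).re ≤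
        ∑' m, dyadicBlock m * ((2 : ℝ) ^ (-σ)) ^ m := by
  have hlim := tendsto_sum_vonMangoldt_log_riemannZeta hσ
  have hW := hsum.tendsto_sum_tsum_nat
  refine ⟨le_of_tendsto_of_tendsto' (hW.const_mul _) hlim fun M => ?_,
    le_of_tendsto_of_tendsto' hlim hW fun M => (sum_vonMangoldt_two_pow_bounds hσ.le M).2⟩
  refine le_trans (le_of_eq ?_) (sum_vonMangoldt_two_pow_bounds hσ.le M).1
  rw [Finset.mul_sum]
  refine Finset.sum_congr rfl fun m _ => ?_
  ring

/-- The blocks telescope to `vonMangoldtLogSum (2 ^ M)`, which is `log M + log log 2 + c + o(1)`;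
the harmonic sum removes `log M + γ`. -/
lemma tendsto_sum_dyadicBlock_sub {c : ℝ}
    (hc : Tendsto (fun N : ℕ => vonMangoldtLogSum N - Real.log (Real.log N)) atTop (𝓝 c)) :
    Tendsto (fun M => ∑ m ∈ Finset.range M, (dyadicBlock m - 1 / ((m : ℝ) + 1))) atTop
      (𝓝 (c + Real.log (Real.log 2) - Real.eulerMascheroniConstant)) := by
  have h1 := (hc.comp (tendsto_pow_atTop_atTop_of_one_lt (one_lt_two (α := ℕ)))).add_const
    (Real.log (Real.log 2))
  refine (h1.sub Real.tendsto_harmonic_sub_log).congr' ?_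
  filter_upwards [eventually_ge_atTop 1] with M hM
  have hM' : (0 : ℝ) < M := by exact_mod_cast hM
  have hlog2 : 0 < Real.log 2 := Real.log_pos one_lt_two
  have telescoped : ∑ m ∈ Finset.range M, dyadicBlock m = vonMangoldtLogSum (2 ^ M) := by
    simp only [dyadicBlock]
    rw [Finset.sum_range_sub (fun m => vonMangoldtLogSum (2 ^ m)), pow_zero,
      vonMangoldtLogSum_one, sub_zero]
  have harmonic_eq : (harmonic M : ℝ) = ∑ m ∈ Finset.range M, 1 / ((m : ℝ) + 1) := by
    rw [harmonic]
    push_cast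
    simp
  simp only [Function.comp_apply]
  rw [Finset.sum_sub_distrib, telescoped, harmonic_eq]
  push_cast
  rw [Real.log_pow, Real.log_mul hM'.ne' hlog2.ne']
  ring

lemma tendsto_two_rpow_neg :
    Tendsto (fun σ : ℝ => (2 : ℝ) ^ (-σ)) (𝓝[>] 0) (𝓝[<] 1) := by
  refine tendsto_nhdsWithin_of_tendsto_nhds_of_eventually_within _ ?_ ?_
  · have : Continuous fun σ : ℝ => (2 : ℝ) ^ (-σ) := by fun_prop (disch := norm_num)
    simpa using (this.tendsto 0).mono_left nhdsWithin_le_nhds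
  · filter_upwards [self_mem_nhdsWithin] with σ hσ
    exact Real.rpow_lt_one_of_one_lt_of_neg one_lt_two (neg_lt_zero.2 hσ)

lemma tendsto_log_one_sub_two_rpow_sub_log :
    Tendsto (fun σ : ℝ => Real.log (1 - (2 : ℝ) ^ (-σ)) - Real.log σ) (𝓝[>] 0)
      (𝓝 (Real.log (Real.log 2))) := by
  have hlog2 : 0 < Real.log 2 := Real.log_pos one_lt_two
  have hderiv : HasDerivAt (fun σ : ℝ => 1 - (2 : ℝ) ^ (-σ)) (Real.log 2) 0 := by
    have := ((hasDerivAt_neg (0 : ℝ)).const_rpow (a := 2) two_pos).const_sub 1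
    simpa using this
  have hslope := (hasDerivAt_iff_tendsto_slope.1 hderiv).mono_left
    (nhdsWithin_mono 0 (fun σ (hσ : 0 < σ) => hσ.ne'))
  refine (((Real.continuousAt_log hlog2.ne').tendsto).comp hslope).congr' ?_
  filter_upwards [self_mem_nhdsWithin] with σ hσ
  have hσ' : 0 < σ := hσ
  have hlt : (2 : ℝ) ^ (-σ) < 1 :=
    Real.rpow_lt_one_of_one_lt_of_neg one_lt_two (neg_lt_zero.2 hσ')
  have hlt' : 0 < 1 - (2 : ℝ) ^ (-σ) := by linarith
  rw [← Real.log_div hlt'.ne' hσ'.ne']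
  simp [slope_def_field]

lemma tendsto_log_riemannZeta_add_log :
    Tendsto (fun σ : ℝ => Real.log (riemannZeta ((1 + σ : ℝ) : ℂ)).re + Real.log σ) (𝓝[>] 0)
      (𝓝 0) := by
  have h := (Asymptotics.isLittleO_one_iff ℝ).1 log_riemannZeta_add_log_sub_isLittleO_ofReal
  have hshift : Tendsto (fun σ : ℝ => 1 + σ) (𝓝[>] 0) (𝓝[>] 1) := by
    refine tendsto_nhdsWithin_of_tendsto_nhds_of_eventually_within _ ?_ ?_
    · have : Continuous fun σ : ℝ => 1 + σ := by fun_prop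
      simpa using (this.tendsto 0).mono_left nhdsWithin_le_nhds
    · filter_upwards [self_mem_nhdsWithin] with σ hσ
      simpa using hσ
  refine (h.comp hshift).congr fun σ => ?_
  simp

/-- The constant in Mertens' second theorem for prime powers is Euler's constant. -/
lemma eq_eulerMascheroniConstant_of_tendsto {c : ℝ}
    (hc : Tendsto (fun N : ℕ => vonMangoldtLogSum N - Real.log (Real.log N)) atTop (𝓝 c)) :
    c = Real.eulerMascheroniConstant := by
  have hpartial := tendsto_sum_dyadicBlock_sub hc
  set ℓ := c + Real.log (Real.log 2) - Real.eulerMascheroniConstant with hℓ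
  set w : ℕ → ℝ := fun m => dyadicBlock m - 1 / ((m : ℝ) + 1) with hw
  -- Abel's theorem. The series without `1 / (m + 1)` diverges at `x = 1`; that part is summed
  -- exactly as `-log (1 - x) / x`.
  have habel : Tendsto (fun x => ∑' m, w m * x ^ m) (𝓝[<] 1) (𝓝 ℓ) :=
    Real.tendsto_tsum_powerSeries_nhdsWithin_lt hpartial
  have hw_zero : Tendsto w atTop (𝓝 0) := by
    have := (hpartial.comp (tendsto_add_atTop_nat 1)).sub hpartial
    rw [sub_self] at this
    refine this.congr fun m => ?_
    simp [Finset.sum_range_succ]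
  obtain ⟨B, hB⟩ := hw_zero.norm.bddAbove_range
  have hw_summable : ∀ x : ℝ, 0 < x → x < 1 → Summable fun m => w m * x ^ m := by
    intro x hx0 hx1
    refine Summable.of_norm_bounded ((summable_geometric_of_lt_one hx0.le hx1).mul_left B)
      fun m => ?_
    rw [norm_mul, Real.norm_of_nonneg (pow_nonneg hx0.le m)]
    exact mul_le_mul_of_nonneg_right (hB ⟨m, rfl⟩) (pow_nonneg hx0.le m)
  have hlog_sum : ∀ x : ℝ, 0 < x → x < 1 →
      HasSum (fun m : ℕ => 1 / ((m : ℝ) + 1) * x ^ m) (-Real.log (1 - x) / x) := by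
    intro x hx0 hx1
    have := (Real.hasSum_pow_div_log_of_abs_lt_one (by rwa [abs_of_pos hx0])).div_const x
    refine this.congr_fun fun m => ?_
    rw [pow_succ]
    field_simp
  have hW : ∀ x : ℝ, 0 < x → x < 1 → HasSum (fun m => dyadicBlock m * x ^ m)
      (∑' m, w m * x ^ m + -Real.log (1 - x) / x) := by
    intro x hx0 hx1
    refine ((hw_summable x hx0 hx1).hasSum.add (hlog_sum x hx0 hx1)).congr_fun fun m => ?_
    simp only [hw]
    ring
  have hx : Tendsto (fun x : ℝ => x) (𝓝[<] 1) (𝓝 1) := nhdsWithin_le_nhds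
  have hlower : Tendsto (fun x : ℝ => x * ∑' m, w m * x ^ m) (𝓝[<] 1) (𝓝 ℓ) := by
    simpa only [one_mul] using hx.mul habel
  have hxlogx : Tendsto (fun x : ℝ => (1 - x) * Real.log (1 - x)) (𝓝[<] 1) (𝓝 0) := by
    have : Continuous fun x : ℝ => (1 - x) * Real.log (1 - x) :=
      Real.continuous_mul_log.comp (continuous_const.sub continuous_id)
    simpa using (this.tendsto 1).mono_left nhdsWithin_le_nhds
  have hupper : Tendsto (fun x : ℝ => ∑' m, w m * x ^ m - (1 - x) * Real.log (1 - x) / x)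
      (𝓝[<] 1) (𝓝 ℓ) := by
    simpa only [zero_div, sub_zero, Pi.div_apply] using habel.sub (hxlogx.div hx one_ne_zero)
  have hmid : Tendsto (fun σ : ℝ => Real.log (riemannZeta ((1 + σ : ℝ) : ℂ)).re +
      Real.log (1 - (2 : ℝ) ^ (-σ))) (𝓝[>] 0) (𝓝 (Real.log (Real.log 2))) := by
    have := tendsto_log_riemannZeta_add_log.add tendsto_log_one_sub_two_rpow_sub_log
    rw [zero_add] at this
    refine this.congr fun σ => ?_
    ring
  -- Adding `log (1 - x)` to the dyadic bounds for `log ζ(1 + σ)` cancels the singularity up to `(1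
  -- - x) log (1 - x) / x → 0`.
  have hsqueeze : Tendsto (fun σ : ℝ => Real.log (riemannZeta ((1 + σ : ℝ) : ℂ)).re +
      Real.log (1 - (2 : ℝ) ^ (-σ))) (𝓝[>] 0) (𝓝 ℓ) := by
    refine tendsto_of_tendsto_of_tendsto_of_le_of_le' (hlower.comp tendsto_two_rpow_neg)
      (hupper.comp tendsto_two_rpow_neg) ?_ ?_ <;>
    · filter_upwards [self_mem_nhdsWithin] with σ hσ
      have hσ' : 0 < σ := hσ
      have hlt : (2 : ℝ) ^ (-σ) < 1 :=
        Real.rpow_lt_one_of_one_lt_of_neg one_lt_two (neg_lt_zero.2 hσ')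
      have hpos : 0 < (2 : ℝ) ^ (-σ) := by positivity
      have hWx := hW _ hpos hlt
      have hb := tsum_dyadicBlock_bounds hσ' hWx.summable
      rw [hWx.tsum_eq] at hb
      simp only [Function.comp_apply]
      set x := (2 : ℝ) ^ (-σ)
      have e1 : x * (∑' m, w m * x ^ m + -Real.log (1 - x) / x) =
          x * ∑' m, w m * x ^ m - Real.log (1 - x) := by field_simp; ring
      have e2 : (1 - x) * Real.log (1 - x) / x = Real.log (1 - x) / x - Real.log (1 - x) := by
        field_simp
      rw [e1] at hb
      rw [neg_div] at hb
      linarith [hb.1, hb.2]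
  have := tendsto_nhds_unique hmid hsqueeze
  linarith

/-! ### From prime powers to the Euler product: Mertens' third theorem. -/

lemma neg_log_sieveDensity (N : ℕ) :
    -Real.log (sieveDensity N) = ∑ p ∈ N.primesLE, -Real.log (1 - (p : ℝ)⁻¹) := by
  rw [sieveDensity, Real.log_prod, Finset.sum_neg_distrib]
  intro p hp
  have hp' : p.Prime := (Nat.mem_primesLE.1 hp).2
  have : (p : ℝ)⁻¹ < 1 := inv_lt_one_of_one_lt₀ (by exact_mod_cast hp'.one_lt)
  linarith

lemma vonMangoldtLogSum_eq_sum_primesLE (N : ℕ) : vonMangoldtLogSum N =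
    ∑ p ∈ N.primesLE, ∑ i ∈ Finset.range (Nat.log p N), ((p : ℝ)⁻¹) ^ (i + 1) / ((i : ℝ) + 1) := by
  have hsupp : vonMangoldtLogSum N = ∑ n ∈ (Finset.Ioc 0 N).filter IsPrimePow,
      ArithmeticFunction.vonMangoldt n / (n * Real.log n) := by
    rw [vonMangoldtLogSum, Finset.sum_filter]
    refine Finset.sum_congr rfl fun n _ => ?_
    split_ifs with h
    · rfl
    · rw [ArithmeticFunction.vonMangoldt_eq_zero_iff.2 h, zero_div]
  rw [hsupp, Finset.sum_sigma']
  symm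
  refine Finset.sum_bij (fun x _ => x.1 ^ (x.2 + 1)) ?_ ?_ ?_ ?_
  · rintro ⟨p, i⟩ hx
    simp only [Finset.mem_sigma, Nat.mem_primesLE, Finset.mem_range] at hx
    obtain ⟨⟨hpN, hp⟩, hi⟩ := hx
    simp only [Finset.mem_filter, Finset.mem_Ioc]
    exact ⟨⟨pow_pos hp.pos _, Nat.pow_le_of_le_log (by have := hp.two_le; omega) hi⟩,
      hp.isPrimePow.pow (by omega)⟩
  · rintro ⟨p, i⟩ hx ⟨q, j⟩ hy h
    simp only [Finset.mem_sigma, Nat.mem_primesLE, Finset.mem_range] at hx hy h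
    obtain ⟨rfl, hij⟩ := hx.1.2.pow_inj' hy.1.2 (by omega) (by omega) h
    obtain rfl : i = j := by omega
    rfl
  · intro n hn
    simp only [Finset.mem_filter, Finset.mem_Ioc] at hn
    obtain ⟨⟨hn0, hnN⟩, hpp⟩ := hn
    obtain ⟨p, k, hp, hk, rfl⟩ := (isPrimePow_nat_iff _).1 hpp
    refine ⟨⟨p, k - 1⟩, ?_, by simp only [Nat.sub_add_cancel hk]⟩
    simp only [Finset.mem_sigma, Nat.mem_primesLE, Finset.mem_range]
    have hlog : k ≤ Nat.log p N := Nat.le_log_of_pow_le hp.one_lt hnN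
    exact ⟨⟨(Nat.le_self_pow hk.ne' p).trans hnN, hp⟩, by omega⟩
  · rintro ⟨p, i⟩ hx
    simp only [Finset.mem_sigma, Nat.mem_primesLE, Finset.mem_range] at hx
    have hp := hx.1.2
    have hlog : 0 < Real.log p := Real.log_pos (by exact_mod_cast hp.one_lt)
    have hp0 : (0 : ℝ) < p := by exact_mod_cast hp.pos
    rw [ArithmeticFunction.vonMangoldt_apply_pow (by omega),
      ArithmeticFunction.vonMangoldt_apply_prime hp]
    push_cast
    rw [Real.log_pow, inv_pow]
    push_cast
    field_simp

/-- The sum over prime powers truncates the series of `-log (1 - 1/p)`. The first omitted power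
exceeds `N` and is at least `p ^ 2`. The minimum of the two bounds tends to 0 in `N` termwise while
remaining dominated by a summable series. -/
lemma neg_log_one_sub_inv_bounds {p N : ℕ} (hp : p.Prime) (hpN : p ≤ N) :
    ∑ i ∈ Finset.range (Nat.log p N), ((p : ℝ)⁻¹) ^ (i + 1) / ((i : ℝ) + 1) ≤
        -Real.log (1 - (p : ℝ)⁻¹) ∧
      -Real.log (1 - (p : ℝ)⁻¹) ≤
        ∑ i ∈ Finset.range (Nat.log p N), ((p : ℝ)⁻¹) ^ (i + 1) / ((i : ℝ) + 1) +
          2 * min (1 / (N : ℝ)) (1 / (p : ℝ) ^ 2) := by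
  have hp2 : (2 : ℝ) ≤ p := by exact_mod_cast hp.two_le
  have hp0 : (0 : ℝ) < p := by linarith
  have hN0 : (0 : ℝ) < N := hp0.trans_le (by exact_mod_cast hpN)
  have hinv0 : 0 < (p : ℝ)⁻¹ := inv_pos.2 hp0
  have hinv : (p : ℝ)⁻¹ ≤ 1 / 2 := by rw [one_div]; exact inv_anti₀ two_pos hp2
  have habs : |(p : ℝ)⁻¹| < 1 := by rw [abs_of_pos hinv0]; linarith
  set K := Nat.log p N with hK
  constructor
  · exact sum_le_hasSum _ (fun i _ => by positivity) (Real.hasSum_pow_div_log_of_abs_lt_one habs)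
  · have h := (abs_le.1 (Real.abs_log_sub_add_sum_range_le habs K)).1
    rw [abs_of_pos hinv0] at h
    have hpow : (p : ℝ)⁻¹ ^ (K + 1) / (1 - (p : ℝ)⁻¹) ≤ 2 * (p : ℝ)⁻¹ ^ (K + 1) := by
      rw [div_le_iff₀ (by linarith)]
      have : 0 < (p : ℝ)⁻¹ ^ (K + 1) := by positivity
      nlinarith
    have h1 : (p : ℝ)⁻¹ ^ (K + 1) ≤ 1 / N := by
      rw [inv_pow, one_div]
      refine inv_anti₀ hN0 ?_
      exact_mod_cast (Nat.lt_pow_succ_log_self hp.one_lt N).le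
    have hK1 : 1 ≤ K := Nat.le_log_of_pow_le hp.one_lt (by rwa [pow_one])
    have h2 : (p : ℝ)⁻¹ ^ (K + 1) ≤ 1 / (p : ℝ) ^ 2 := by
      rw [inv_pow, one_div]
      refine inv_anti₀ (by positivity) (pow_le_pow_right₀ (by linarith) (by omega))
    have h3 := le_min h1 h2
    linarith

lemma vonMangoldtLogSum_le_neg_log_sieveDensity (N : ℕ) :
    vonMangoldtLogSum N ≤ -Real.log (sieveDensity N) := by
  rw [neg_log_sieveDensity, vonMangoldtLogSum_eq_sum_primesLE]
  exact Finset.sum_le_sum fun p hp =>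
    (neg_log_one_sub_inv_bounds (Nat.mem_primesLE.1 hp).2 (Nat.mem_primesLE.1 hp).1).1

lemma summable_one_div_nat_sq : Summable fun n : ℕ => 1 / (n : ℝ) ^ 2 :=
  Real.summable_one_div_nat_pow.2 one_lt_two

lemma summable_min_inv (N : ℕ) :
    Summable fun n : ℕ => min (1 / (N : ℝ)) (1 / (n : ℝ) ^ 2) :=
  Summable.of_nonneg_of_le (fun _ => le_min (by positivity) (by positivity))
    (fun _ => min_le_right _ _) summable_one_div_nat_sq

lemma neg_log_sieveDensity_le (N : ℕ) : -Real.log (sieveDensity N) ≤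
    vonMangoldtLogSum N + 2 * ∑' n : ℕ, min (1 / (N : ℝ)) (1 / (n : ℝ) ^ 2) := by
  have hnonneg : ∀ n : ℕ, 0 ≤ min (1 / (N : ℝ)) (1 / (n : ℝ) ^ 2) :=
    fun n => le_min (by positivity) (by positivity)
  have htail : ∑ p ∈ N.primesLE, min (1 / (N : ℝ)) (1 / (p : ℝ) ^ 2) ≤
      ∑' n : ℕ, min (1 / (N : ℝ)) (1 / (n : ℝ) ^ 2) :=
    (summable_min_inv N).sum_le_tsum _ fun n _ => hnonneg n
  rw [neg_log_sieveDensity, vonMangoldtLogSum_eq_sum_primesLE]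
  calc _ ≤ ∑ p ∈ N.primesLE, (∑ i ∈ Finset.range (Nat.log p N),
          ((p : ℝ)⁻¹) ^ (i + 1) / ((i : ℝ) + 1) + 2 * min (1 / (N : ℝ)) (1 / (p : ℝ) ^ 2)) :=
        Finset.sum_le_sum fun p hp =>
          (neg_log_one_sub_inv_bounds (Nat.mem_primesLE.1 hp).2 (Nat.mem_primesLE.1 hp).1).2
    _ ≤ _ := by
      rw [Finset.sum_add_distrib, ← Finset.mul_sum]
      linarith

lemma tendsto_tsum_min_inv :
    Tendsto (fun N : ℕ => ∑' n : ℕ, min (1 / (N : ℝ)) (1 / (n : ℝ) ^ 2)) atTop (𝓝 0) := by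
  have h := tendsto_tsum_of_dominated_convergence (𝓕 := atTop)
    (f := fun N n : ℕ => min (1 / (N : ℝ)) (1 / (n : ℝ) ^ 2)) (g := fun _ => 0)
    summable_one_div_nat_sq (fun n => ?_) (Eventually.of_forall fun N n => ?_)
  · simpa using h
  · refine squeeze_zero (fun N => le_min (by positivity) (by positivity))
      (fun N => min_le_left _ _) ?_
    exact tendsto_one_div_atTop_nhds_zero_nat
  · rw [Real.norm_of_nonneg (le_min (by positivity) (by positivity))]
    exact min_le_right _ _

/-- An explicit lower bound in Mertens' third theorem. -/
lemma neg_log_sieveDensity_ge {N : ℕ} (hN : 10000 ≤ N) :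
    Real.log (Real.log N) + Real.eulerMascheroniConstant - 13 / 4 / Real.log N ≤
      -Real.log (sieveDensity N) := by
  obtain ⟨c, hc, hle⟩ := exists_tendsto_vonMangoldtLogSum_sub
  rw [eq_eulerMascheroniConstant_of_tendsto hc] at hle
  have h1 := hle N hN
  have h2 := vonMangoldtLogSum_le_neg_log_sieveDensity N
  linarith

/-- Mertens' third theorem. -/
lemma tendsto_sieveDensity_mul :
    Tendsto (fun N : ℕ => sieveDensity N *
      (Real.exp Real.eulerMascheroniConstant * Real.log N)) atTop (𝓝 1) := by
  obtain ⟨c, hc, -⟩ := exists_tendsto_vonMangoldtLogSum_sub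
  rw [eq_eulerMascheroniConstant_of_tendsto hc] at hc
  have hlog : Tendsto (fun N : ℕ => -Real.log (sieveDensity N) - Real.log (Real.log N)) atTop
      (𝓝 Real.eulerMascheroniConstant) := by
    have hupper := hc.add (tendsto_tsum_min_inv.const_mul 2)
    rw [mul_zero, add_zero] at hupper
    refine tendsto_of_tendsto_of_tendsto_of_le_of_le hc hupper (fun N => ?_) (fun N => ?_)
    · exact sub_le_sub_right (vonMangoldtLogSum_le_neg_log_sieveDensity N) _
    · have := neg_log_sieveDensity_le N
      simp only
      linarith
  have hexp := (Real.continuous_exp.tendsto 0).comp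
    ((tendsto_const_nhds (x := Real.eulerMascheroniConstant)).sub hlog |>.trans
      (by rw [sub_self]))
  rw [Real.exp_zero] at hexp
  refine hexp.congr' ?_
  filter_upwards [eventually_ge_atTop 2] with N hN
  have hlogN : 0 < Real.log N := Real.log_pos (by exact_mod_cast hN)
  simp only [Function.comp_apply]
  rw [show Real.eulerMascheroniConstant - (-Real.log (sieveDensity N) - Real.log (Real.log N)) =
    Real.log (sieveDensity N) + (Real.eulerMascheroniConstant + Real.log (Real.log N)) by ring,
    Real.exp_add, Real.exp_add, Real.exp_log (sieveDensity_pos N), Real.exp_log hlogN]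

/-! ### Density estimates valid for every `k ≥ 2`. -/

/-- By the Euler product the right side is `∑ 1/m` over integers `m` with all prime factors at most
`N`, which include `1, …, N`. -/
lemma log_add_one_le_inv_sieveDensity (N : ℕ) :
    Real.log ((N : ℝ) + 1) ≤ (sieveDensity N)⁻¹ := by
  let f : ℕ →* ℝ :=
    { toFun := fun n => (n : ℝ)⁻¹
      map_one' := by simp
      map_mul' := fun m n => by push_cast; rw [mul_inv] }
  have h := (EulerProduct.summable_and_hasSum_smoothNumbers_prod_primesBelow_geometric (f := f)
    (fun {p} hp => by
      change ‖(p : ℝ)⁻¹‖ < 1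
      rw [norm_inv, Real.norm_natCast]
      exact inv_lt_one_of_one_lt₀ (by exact_mod_cast hp.one_lt)) (N + 1)).2
  have hprod : ∏ p ∈ (N + 1).primesBelow, (1 - f p)⁻¹ = (sieveDensity N)⁻¹ := by
    rw [sieveDensity, ← Finset.prod_inv_distrib]
    rfl
  rw [hprod] at h
  have hharm : (harmonic N : ℝ) = ∑ n ∈ Finset.Icc 1 N, (n : ℝ)⁻¹ := by
    rw [harmonic_eq_sum_Icc]
    push_cast
    rfl
  have hlog : Real.log ((N : ℝ) + 1) ≤ harmonic N := by
    exact_mod_cast log_add_one_le_harmonic N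
  refine hlog.trans ?_
  rw [hharm, ← Finset.sum_attach]
  have hmem : ∀ n ∈ Finset.Icc 1 N, n ∈ (N + 1).smoothNumbers := fun n hn => by
    obtain ⟨h1, h2⟩ := Finset.mem_Icc.1 hn
    exact Nat.mem_smoothNumbers_of_lt h1 (by omega)
  let ι : (Finset.Icc 1 N : Finset ℕ) → (N + 1).smoothNumbers := fun n => ⟨n, hmem n n.2⟩
  have hι : Function.Injective ι := fun a b hab => Subtype.ext (Subtype.mk.inj hab)
  have hsum := sum_le_hasSum ((Finset.Icc 1 N).attach.map ⟨ι, hι⟩)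
    (fun n _ => by change (0 : ℝ) ≤ ((n : ℕ) : ℝ)⁻¹; positivity) h
  rw [Finset.sum_map] at hsum
  exact hsum

lemma exp_eulerMascheroniConstant_le_two : Real.exp Real.eulerMascheroniConstant ≤ 2 := by
  have h1 : Real.exp Real.eulerMascheroniConstant ≤ Real.exp (2 / 3) :=
    Real.exp_le_exp.2 Real.eulerMascheroniConstant_lt_two_thirds.le
  have h2 : Real.exp (2 / 3) ^ 3 ≤ 2 ^ 3 := by
    rw [← Real.exp_nat_mul, show ((3 : ℕ) : ℝ) * (2 / 3) = 1 + 1 by norm_num, Real.exp_add]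
    have := Real.exp_one_lt_d9
    have := Real.exp_pos 1
    nlinarith
  exact h1.trans (le_of_pow_le_pow_left₀ (by norm_num) (by norm_num) h2)

/-- By convexity it suffices to compare the two sides at the endpoints `1/2` and `21/2`. -/
lemma exp_div_three_le {x : ℝ} (h1 : 1 / 2 ≤ x) (h2 : x ≤ 21 / 2) :
    Real.exp (x / 3) ≤ 4 * x := by
  have he : Real.exp 1 < 2.7182818286 := Real.exp_one_lt_d9
  have hleft : Real.exp (1 / 6) ≤ 2 := by
    have h := Real.exp_bound_div_one_sub_of_interval (x := 1 / 6) (by norm_num) (by norm_num)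
    linarith
  have hright : Real.exp (7 / 2) ≤ 42 := by
    have h : Real.exp (7 / 2) ^ 2 ≤ 42 ^ 2 := by
      rw [← Real.exp_nat_mul, show ((2 : ℕ) : ℝ) * (7 / 2) = (7 : ℕ) * 1 by norm_num,
        Real.exp_nat_mul]
      calc Real.exp 1 ^ 7 ≤ 2.7182818286 ^ 7 := by gcongr
        _ ≤ 42 ^ 2 := by norm_num
    exact le_of_pow_le_pow_left₀ (by norm_num) (by norm_num) h
  have ha : 0 ≤ (21 / 2 - x) / 10 := by linarith
  have hb : 0 ≤ (x - 1 / 2) / 10 := by linarith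
  have hconv := convexOn_exp.2 (Set.mem_univ (1 / 6 : ℝ)) (Set.mem_univ (7 / 2 : ℝ)) ha hb (by ring)
  simp only [smul_eq_mul] at hconv
  rw [show (21 / 2 - x) / 10 * (1 / 6) + (x - 1 / 2) / 10 * (7 / 2) = x / 3 by ring] at hconv
  nlinarith

lemma sieveDensity_le_of_large {N : ℕ} {x : ℝ} (hx : 21 / 2 < x)
    (hN : x ≤ Real.log ((N : ℝ) + 1)) :
    sieveDensity N ≤ 3 / 2 / (Real.exp Real.eulerMascheroniConstant * x) := by
  have hlarge : 10000 ≤ N := by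
    have h1 : Real.exp 10 < (N : ℝ) + 1 := by
      rw [← Real.lt_log_iff_exp_lt (by positivity)]
      linarith
    have h2 : (10001 : ℝ) ≤ Real.exp 10 := by
      rw [show (10 : ℝ) = (10 : ℕ) * 1 by norm_num, Real.exp_nat_mul]
      calc (10001 : ℝ) ≤ 2.7 ^ 10 := by norm_num
        _ ≤ Real.exp 1 ^ 10 := by
          gcongr
          linarith [Real.exp_one_gt_d9]
    have h3 : (10000 : ℝ) < N := by linarith
    exact_mod_cast h3.le
  have hN' : (10000 : ℝ) ≤ N := by exact_mod_cast hlarge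
  obtain ⟨hpos, -, hsucc⟩ := log_succ_bounds (N := N) (by omega)
  push_cast at hsucc
  have hinv : 1 / (N : ℝ) ≤ 1 / 10000 := one_div_le_one_div_of_le (by norm_num) hN'
  set l := Real.log N with hl
  have hl10 : 104 / 10 ≤ l := by linarith
  have hmertens := neg_log_sieveDensity_ge hlarge
  rw [← hl] at hmertens
  -- The constants fit exactly: `(13/4) / (104/10) = 5/16`, `exp (5/16) ≤ 16/11`, and `16/11 * 33/32
  -- = 3/2`.
  have hratio : 13 / 4 / l ≤ 5 / 16 := by
    rw [div_le_iff₀ hpos]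
    linarith
  have hexp : Real.exp (5 / 16) ≤ 16 / 11 := by
    have h := Real.exp_bound_div_one_sub_of_interval (x := 5 / 16) (by norm_num) (by norm_num)
    linarith
  have hδ : sieveDensity N ≤
      Real.exp (5 / 16 - Real.eulerMascheroniConstant - Real.log l) := by
    rw [← Real.log_le_iff_le_exp (sieveDensity_pos N)]
    linarith
  have hg := Real.exp_pos Real.eulerMascheroniConstant
  rw [Real.exp_sub, Real.exp_sub, Real.exp_log hpos, div_div] at hδ
  refine hδ.trans ?_
  rw [div_le_div_iff₀ (by positivity) (by positivity)]
  calc Real.exp (5 / 16) * (Real.exp Real.eulerMascheroniConstant * x)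
      ≤ 16 / 11 * (Real.exp Real.eulerMascheroniConstant * (l * (33 / 32))) := by
        gcongr
        linarith
    _ = 3 / 2 * (Real.exp Real.eulerMascheroniConstant * l) := by ring

/-- Split `1/x = 3/(4x) + 1/(4x)`: the first part is absorbed using `e ^ γ ≤ 2`, the second using
`exp (x/3) ≤ 4x`. -/
lemma sieveDensity_le_of_small {N : ℕ} {x : ℝ} (h1 : 1 / 2 ≤ x) (h2 : x ≤ 21 / 2)
    (hN : x ≤ Real.log ((N : ℝ) + 1)) :
    sieveDensity N ≤
      3 / 2 / (Real.exp Real.eulerMascheroniConstant * x) + (Real.exp (x / 3))⁻¹ := by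
  have hx : 0 < x := by linarith
  have hδ : sieveDensity N ≤ x⁻¹ := by
    rw [le_inv_comm₀ (sieveDensity_pos N) hx]
    exact hN.trans (log_add_one_le_inv_sieveDensity N)
  have hexp : (4 * x)⁻¹ ≤ (Real.exp (x / 3))⁻¹ :=
    inv_anti₀ (Real.exp_pos _) (exp_div_three_le h1 h2)
  have hg : 3 / 2 / (2 * x) ≤ 3 / 2 / (Real.exp Real.eulerMascheroniConstant * x) := by
    have := exp_eulerMascheroniConstant_le_two
    gcongr
  have : x⁻¹ = 3 / 2 / (2 * x) + (4 * x)⁻¹ := by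
    field_simp
    norm_num
  linarith

lemma sieveDensity_floor_le {k : ℕ} (hk : 2 ≤ k) :
    sieveDensity ⌊(k : ℝ) ^ (3 / 4 : ℝ)⌋₊ ≤
      2 / (Real.exp Real.eulerMascheroniConstant * Real.log k) + 1 / (k : ℝ) ^ (1 / 4 : ℝ) := by
  have hk' : (2 : ℝ) ≤ k := by exact_mod_cast hk
  have hk0 : (0 : ℝ) < k := by linarith
  set N := ⌊(k : ℝ) ^ (3 / 4 : ℝ)⌋₊ with hNdef
  -- In this variable `k ^ (1/4) = exp (x/3)`, and `k ≥ 2` gives `x ≥ 1/2`.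
  set x := 3 / 4 * Real.log k with hx
  have hlog2 : 2 / 3 ≤ Real.log k :=
    le_trans (by linarith [Real.log_two_gt_d9]) (Real.log_le_log two_pos hk')
  have hxN : x ≤ Real.log ((N : ℝ) + 1) := by
    rw [hx, ← Real.log_rpow hk0]
    exact Real.log_le_log (by positivity) (Nat.lt_floor_add_one _).le
  have hquarter : 1 / (k : ℝ) ^ (1 / 4 : ℝ) = (Real.exp (x / 3))⁻¹ := by
    rw [Real.rpow_def_of_pos hk0, one_div, hx]
    ring_nf
  have hmain : 2 / (Real.exp Real.eulerMascheroniConstant * Real.log k) =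
      3 / 2 / (Real.exp Real.eulerMascheroniConstant * x) := by
    rw [hx]
    have : 0 < Real.log k := by linarith
    field_simp
    norm_num
  rw [hquarter, hmain]
  rcases le_or_gt x (21 / 2) with h | h
  · exact sieveDensity_le_of_small (by rw [hx]; linarith) h hxN
  · have := sieveDensity_le_of_large h hxN
    have : 0 < (Real.exp (x / 3))⁻¹ := by positivity
    linarith

/-! ### The cardinality bound, thresholds and asymptotics. -/

lemma card_le_sidonBound {k n : ℕ} {ε : ℝ} (hk : 2 ≤ k)
    (hn : (primorial ⌊(k : ℝ) ^ (3 / 4 : ℝ)⌋₊ : ℝ) ≤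
      ε * n / (Real.exp Real.eulerMascheroniConstant * Real.log k))
    {A : Finset ℕ} (hA : A ⊆ Finset.Icc 1 n) (hmul : IsKMultiplicative k (A : Set ℕ)) :
    (A.card : ℝ) ≤ sidonBound k ε n := by
  have hk0 : (0 : ℝ) < k := by exact_mod_cast (by omega : 0 < k)
  set N := ⌊(k : ℝ) ^ (3 / 4 : ℝ)⌋₊ with hN
  have hcard : (A.card : ℝ) ≤ roughCount N n + (n : ℝ) * N / k := by
    have h := card_le_roughCount_add N (by omega) hA hmul
    have h' : ((n * N / k : ℕ) : ℝ) ≤ (n : ℝ) * N / k := by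
      exact_mod_cast (Nat.cast_div_le (α := ℝ) (m := n * N) (n := k))
    have h'' : (A.card : ℝ) ≤ roughCount N n + (n * N / k : ℕ) := by exact_mod_cast h
    linarith
  have hrough := (abs_le.1 (abs_roughCount_sub_le N n)).2
  have hδ := mul_le_mul_of_nonneg_right (sieveDensity_floor_le hk) (Nat.cast_nonneg (α := ℝ) n)
  rw [← hN] at hδ
  have hNk : (n : ℝ) * N / k ≤ n / (k : ℝ) ^ (1 / 4 : ℝ) := by
    rw [div_le_div_iff₀ hk0 (by positivity)]
    have hfloor : (N : ℝ) ≤ (k : ℝ) ^ (3 / 4 : ℝ) := Nat.floor_le (by positivity)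
    calc (n : ℝ) * N * (k : ℝ) ^ (1 / 4 : ℝ)
        ≤ n * (k : ℝ) ^ (3 / 4 : ℝ) * (k : ℝ) ^ (1 / 4 : ℝ) := by gcongr
      _ = n * k := by
        rw [mul_assoc, ← Real.rpow_add hk0]
        norm_num
  have hbound : sidonBound k ε n =
      (2 / (Real.exp Real.eulerMascheroniConstant * Real.log k) + 1 / (k : ℝ) ^ (1 / 4 : ℝ)) * n +
        ε * n / (Real.exp Real.eulerMascheroniConstant * Real.log k) +
          n / (k : ℝ) ^ (1 / 4 : ℝ) := by
    rw [sidonBound]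
    ring
  rw [hbound]
  linarith

lemma exists_threshold (k : ℕ) (ε : ℝ) : ∃ N : ℕ, 2 ≤ k → 0 < ε → ∀ n : ℕ, N < n →
    (∀ A : Finset ℕ, A ⊆ Finset.Icc 1 n → IsKMultiplicative k (A : Set ℕ) →
      (A.card : ℝ) ≤ sidonBound k ε n) ∧
    |(roughCount k n : ℝ) - sieveDensity k * n| ≤ sieveDensity k * n / k := by
  by_cases hkε : 2 ≤ k ∧ 0 < ε
  swap
  -- An arbitrary value outside the relevant range makes the threshold a total function of `k` and
  -- `ε`.
  · exact ⟨0, fun h1 h2 => absurd ⟨h1, h2⟩ hkε⟩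
  obtain ⟨hk, hε⟩ := hkε
  have hk0 : (0 : ℝ) < k := by exact_mod_cast (by omega : 0 < k)
  have hlog : 0 < Real.log k := Real.log_pos (by exact_mod_cast hk)
  have hδ := sieveDensity_pos k
  have hg := Real.exp_pos Real.eulerMascheroniConstant
  have h1 : Tendsto (fun n : ℕ =>
      ε * n / (Real.exp Real.eulerMascheroniConstant * Real.log k)) atTop atTop :=
    (tendsto_natCast_atTop_atTop.const_mul_atTop hε).atTop_div_const (by positivity)
  have h2 : Tendsto (fun n : ℕ => sieveDensity k * n / k) atTop atTop :=
    (tendsto_natCast_atTop_atTop.const_mul_atTop hδ).atTop_div_const hk0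
  obtain ⟨N, hN⟩ := eventually_atTop.1 ((h1.eventually_ge_atTop
    (primorial ⌊(k : ℝ) ^ (3 / 4 : ℝ)⌋₊ : ℝ)).and (h2.eventually_ge_atTop (primorial k : ℝ)))
  refine ⟨N, fun _ _ n hn => ⟨fun A hA hmul => ?_, ?_⟩⟩
  · exact card_le_sidonBound hk (hN n hn.le).1 hA hmul
  · exact (abs_roughCount_sub_le k n).trans (hN n hn.le).2

lemma tendsto_two_mul_log_div_rpow : Tendsto (fun k : ℕ =>
    2 * (Real.exp Real.eulerMascheroniConstant * Real.log k) / (k : ℝ) ^ (1 / 4 : ℝ))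
    atTop (𝓝 0) := by
  have h := ((isLittleO_log_rpow_atTop (r := 1 / 4) (by norm_num)).tendsto_div_nhds_zero.comp
    tendsto_natCast_atTop_atTop).const_mul (2 * Real.exp Real.eulerMascheroniConstant)
  rw [mul_zero] at h
  refine h.congr fun k => ?_
  simp only [Function.comp_apply]
  ring

lemma sidonBound_asymptotics {η : ℝ} (hη : 0 < η) : ∃ K : ℕ, ∃ ε₀ : ℝ, 0 < ε₀ ∧
    ∀ k : ℕ, 2 ≤ k → K ≤ k → ∀ ε : ℝ, 0 < ε → ε ≤ ε₀ → ∀ n : ℕ,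
      |(roughCount k n : ℝ) - sieveDensity k * n| ≤ sieveDensity k * n / k →
        |sidonBound k ε n - 2 * (roughCount k n : ℝ)| ≤ η * (roughCount k n : ℝ) ∧
          |sidonBound k ε n - 2 * mertensMain k n| ≤ η * mertensMain k n := by
  -- The errors add up to `t + 2 (t/4) + 2 (t/2) ≤ 3 t` times `mertensMain k n`. Since `t ≤ 1/2`,
  -- that quantity is at most `2 * roughCount k n`, whence `6 t ≤ η`.
  obtain ⟨t, ht0, ht1, htη⟩ : ∃ t : ℝ, 0 < t ∧ t ≤ 1 / 2 ∧ 6 * t ≤ η :=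
    ⟨min (1 / 2) (η / 6), by positivity, min_le_left _ _, by
      linarith [min_le_right (1 / 2) (η / 6)]⟩
  have hmertens := tendsto_sieveDensity_mul.eventually
    (Metric.closedBall_mem_nhds 1 (by positivity : 0 < t / 4))
  have hquarter := tendsto_two_mul_log_div_rpow.eventually_le_const
    (by positivity : 0 < t / 2)
  have hinv := tendsto_one_div_atTop_nhds_zero_nat.eventually_le_const
    (by positivity : 0 < t / 4)
  obtain ⟨K, hK⟩ := eventually_atTop.1 ((hmertens.and hquarter).and hinv)
  refine ⟨K, t / 2, by positivity, fun k hk2 hk ε hε0 hε n hrough => ?_⟩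
  obtain ⟨⟨h1, h2⟩, h3⟩ := hK k hk
  rw [Real.dist_eq] at h1
  have hk0 : (0 : ℝ) < k := by exact_mod_cast (by omega : 0 < k)
  have hlog : 0 < Real.log k := Real.log_pos (by exact_mod_cast hk2)
  have hg := Real.exp_pos Real.eulerMascheroniConstant
  have hk4 : 0 < (k : ℝ) ^ (1 / 4 : ℝ) := by positivity
  set ρ := Real.exp Real.eulerMascheroniConstant * Real.log k with hρ
  have hρ0 : 0 < ρ := by positivity
  set μ := mertensMain k n with hμ
  have hμρ : (n : ℝ) = μ * ρ := by
    rw [hμ, mertensMain, ← hρ]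
    field_simp
  have hμ0 : 0 ≤ μ := by
    rw [hμ, mertensMain]
    positivity
  have hB : sidonBound k ε n = 2 * μ + (ε + 2 * ρ / (k : ℝ) ^ (1 / 4 : ℝ)) * μ := by
    rw [sidonBound, ← hρ, hμρ]
    field_simp
    ring
  have hBμ : |sidonBound k ε n - 2 * μ| ≤ t * μ := by
    rw [hB, add_sub_cancel_left, abs_of_nonneg (by positivity)]
    exact mul_le_mul_of_nonneg_right (by linarith) hμ0
  have hδn : sieveDensity k * n = sieveDensity k * ρ * μ := by
    rw [hμρ]
    ring
  have hδμ : |sieveDensity k * n - μ| ≤ t / 4 * μ := by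
    rw [hδn, show sieveDensity k * ρ * μ - μ = (sieveDensity k * ρ - 1) * μ by ring, abs_mul,
      abs_of_nonneg hμ0]
    exact mul_le_mul_of_nonneg_right h1 hμ0
  have hRδ : sieveDensity k * n / k ≤ t / 2 * μ := by
    have hle : sieveDensity k * ρ ≤ 2 := by linarith [(abs_le.1 h1).2]
    rw [hδn, div_eq_mul_one_div]
    calc sieveDensity k * ρ * μ * (1 / k) ≤ 2 * μ * (t / 4) := by gcongr
      _ = t / 2 * μ := by ring
  have htμ : t * μ ≤ 1 / 2 * μ := mul_le_mul_of_nonneg_right ht1 hμ0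
  have hBμ' := abs_le.1 hBμ
  have hδμ' := abs_le.1 hδμ
  have hrough' := abs_le.1 hrough
  have hRμ : μ ≤ 2 * (roughCount k n : ℝ) := by linarith
  have hRη : 3 * (t * μ) ≤ η * (roughCount k n : ℝ) :=
    calc 3 * (t * μ) = 3 * t * μ := by ring
      _ ≤ 3 * t * (2 * (roughCount k n : ℝ)) := by gcongr
      _ = 6 * t * (roughCount k n : ℝ) := by ring
      _ ≤ η * (roughCount k n : ℝ) := by gcongr
  refine ⟨abs_le.2 ⟨by linarith, by linarith⟩, hBμ.trans ?_⟩
  exact mul_le_mul_of_nonneg_right (by linarith) hμ0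

theorem mainTheorem5 :
    -- one threshold `N k ε` for the bound and for both of its asymptotic evaluations
    (∃ N : ℕ → ℝ → ℕ,
      (∀ k : ℕ, 2 ≤ k → ∀ ε : ℝ, 0 < ε → ∀ n : ℕ, N k ε < n →
        ∀ A : Finset ℕ, A ⊆ Finset.Icc 1 n → IsKMultiplicative k (A : Set ℕ) →
          (A.card : ℝ) ≤ sidonBound k ε n) ∧
      (∀ η : ℝ, 0 < η → ∃ K : ℕ, ∃ ε₀ : ℝ, 0 < ε₀ ∧
        ∀ k : ℕ, 2 ≤ k → K ≤ k → ∀ ε : ℝ, 0 < ε → ε ≤ ε₀ → ∀ n : ℕ, N k ε < n →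
          |sidonBound k ε n - 2 * (roughCount k n : ℝ)| ≤ η * (roughCount k n : ℝ) ∧
          |sidonBound k ε n - 2 * mertensMain k n| ≤ η * mertensMain k n)) ∧
    -- `S_k` is `k`-multiplicative and optimal up to a factor `2 + o(1)`
    (∀ k : ℕ, 1 ≤ k → IsKMultiplicative k (roughSet k)) ∧
    (∀ η : ℝ, 0 < η → ∃ K : ℕ, ∀ k : ℕ, K ≤ k → ∃ N : ℕ, ∀ n : ℕ, N < n →
      ∀ A : Finset ℕ, A ⊆ Finset.Icc 1 n → IsKMultiplicative k (A : Set ℕ) →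
        (A.card : ℝ) ≤ (2 + η) * (roughCount k n : ℝ)) := by
  choose N hN using exists_threshold
  have bound : ∀ k : ℕ, 2 ≤ k → ∀ ε : ℝ, 0 < ε → ∀ n : ℕ, N k ε < n →
      ∀ A : Finset ℕ, A ⊆ Finset.Icc 1 n → IsKMultiplicative k (A : Set ℕ) →
        (A.card : ℝ) ≤ sidonBound k ε n :=
    fun k hk ε hε n hn => (hN k ε hk hε n hn).1
  refine ⟨⟨N, bound, fun η hη => ?_⟩, fun k _ => roughSet_isKMultiplicative, fun η hη => ?_⟩ <;>
    obtain ⟨K, ε₀, hε₀, h⟩ := sidonBound_asymptotics hη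
  · exact ⟨K, ε₀, hε₀, fun k hk hKk ε hε hεle n hn =>
      h k hk hKk ε hε hεle n (hN k ε hk hε n hn).2⟩
  · refine ⟨max K 2, fun k hk => ⟨N k ε₀, fun n hn A hA hmul => ?_⟩⟩
    have hk2 : 2 ≤ k := le_of_max_le_right hk
    have h1 := bound k hk2 ε₀ hε₀ n hn A hA hmul
    have h2 := (abs_le.1 (h k hk2 (le_of_max_le_left hk) ε₀ hε₀ le_rfl n
      (hN k ε₀ hk2 hε₀ n hn).2).1).2
    linarith
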